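/- Let $m\ge 1$ and let $X\subseteq\mathbb{R}^n$ be nonempty, convex and compact. For $i=1,\dots,m$ let $F_i:\mathbb{R}^n\to\mathbb{R}^n$ be continuous and monotone on $X$, and let $f_i:\mathbb{R}^n\to\mathbb{R}$ be continuously differentiable (in a neighbourhood of each point of $X$) and $\mu_{f_i}$-strongly convex on $X$ with $\mu_{f_i}>0$. Put $\mu_{\min}=\min_{1\le i\le m}\mu_{f_i}$, and let $C_F,C_f>0$ be such that $\|F_i(x)\|\le C_F/m$ and $\|\nabla f_i(x)\|\le C_f/m$ for all $x\in X$ and all $i$ (Euclidean norm). Let $\gamma_k=\gamma/(k+\Gamma)^a$ and $\eta_k=\eta/(k+\Gamma)^b$ for $k\ge 0$, where $\gamma,\eta,a,b>0$, $a>b$, $a+b<1$, $3a+b<2$, $\Gamma\ge 1$, $\Gamma^{a+b}\ge 2\gamma\eta\mu_{\min}$ and $\Gamma^{1-a-b}\ge 4/(\gamma\eta\mu_{\min})$. Starting from an arbitrary $x_{0,1}\in X$, define for $k\ge 0$ $$x_{k,i+1}=\mathcal{P}_X\bigl(x_{k,i}-\gamma_k\,(F_i(x_{k,i})+\eta_k\nabla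 f_i(x_{k,i}))\bigr)\quad(i=1,\dots,m),\qquad x_{k+1,1}=x_{k,m+1},$$ where $\mathcal{P}_X$ is the Euclidean projection onto $X$, and write $x_1=x_{1,1}$. Then for every $k\ge 0$ the variational inequality $\mathrm{VI}\bigl(X,\sum_{i=1}^m(F_i+\eta_k\nabla f_i)\bigr)$, that is, the problem of finding $x\in X$ with $(y-x)^T\sum_{i=1}^m(F_i(x)+\eta_k\nabla f_i(x))\ge 0$ for all $y\in X$, has a unique solution $x^*_{\eta_k}$, and for every $k\ge 0$ and every $i\in\{1,\dots,m\}$ $$\|x_{k+1,i}-x^*_{\eta_k}\|^2\le\frac{2(i-1)^2(C_F+\eta_0C_f)^2\gamma^2}{m^2(k+\Gamma+1)^{2a}}+\frac{2\tau B_0\gamma}{\mu_{\min}\,\eta\,(k+\Gamma)^{a-b}},$$ where $$B_0=\frac{1.5\,C_f^2}{m^2\mu_{\min}^3\gamma^3\eta\,\Gamma^{2-3a-b}}+(C_F+\eta_0C_f)^2,\qquad \tau=\max\Bigl\{\frac{\mu_{\min}\,\eta\,\Gamma^{a-b}\,\|x_1-x^*_{\eta_0}\|^2}{\gamma B_0},\,2\Bigr\}.$$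 -/

import Mathlib

open scoped Gradient InnerProductSpace

noncomputable section

/-- The solution set `SOL(X, G)` of the variational inequality `VI(X, G)`. -/
def VISol {n : ℕ} (X : Set (EuclideanSpace ℝ (Fin n)))
    (G : EuclideanSpace ℝ (Fin n) → EuclideanSpace ℝ (Fin n)) :
    Set (EuclideanSpace ℝ (Fin n)) :=
  {x | x ∈ X ∧ ∀ y ∈ X, 0 ≤ ⟪G x, y - x⟫_ℝ}

/-- The mapping `G` is monotone on the set `X`. -/
def MonotoneMapOn {n : ℕ} (X : Set (EuclideanSpace ℝ (Fin n)))
    (G : EuclideanSpace ℝ (Fin n) → EuclideanSpace ℝ (Fin n)) : Prop :=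
  ∀ x ∈ X, ∀ y ∈ X, 0 ≤ ⟪G x - G y, x - y⟫_ℝ

/-- The Euclidean projection of `z` onto `X`, i.e. the point of `X` nearest to `z`.  It exists and
is unique when `X` is nonempty, closed and convex (see `euclProj_spec` and `eq_euclProj`). -/
def euclProj {n : ℕ} (X : Set (EuclideanSpace ℝ (Fin n))) (z : EuclideanSpace ℝ (Fin n)) :
    EuclideanSpace ℝ (Fin n) :=
  Classical.epsilon fun p => p ∈ X ∧ ∀ y ∈ X, ‖p - z‖ ≤ ‖y - z‖

theorem euclProj_spec {n : ℕ} {X : Set (EuclideanSpace ℝ (Fin n))} (hne : X.Nonempty)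
    (hcl : IsClosed X) (z : EuclideanSpace ℝ (Fin n)) :
    euclProj X z ∈ X ∧ ∀ y ∈ X, ‖euclProj X z - z‖ ≤ ‖y - z‖ := by
  have h : ∃ p, p ∈ X ∧ ∀ y ∈ X, ‖p - z‖ ≤ ‖y - z‖ := by
    obtain ⟨p, hp, hd⟩ := hcl.exists_infDist_eq_dist hne z
    refine ⟨p, hp, fun y hy => ?_⟩
    have := Metric.infDist_le_dist_of_mem (x := z) hy
    rw [hd, dist_comm z p, dist_comm z y, dist_eq_norm, dist_eq_norm] at this
    exact this
  exact Classical.epsilon_spec h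

theorem eq_euclProj {n : ℕ} {X : Set (EuclideanSpace ℝ (Fin n))} (hcl : IsClosed X)
    (hX : Convex ℝ X) {z p : EuclideanSpace ℝ (Fin n)} (hp : p ∈ X)
    (hmin : ∀ y ∈ X, ‖p - z‖ ≤ ‖y - z‖) : p = euclProj X z := by
  obtain ⟨hq, hqmin⟩ := euclProj_spec ⟨p, hp⟩ hcl z
  set q := euclProj X z
  have hmid := hmin _ (hX hp hq (by norm_num : (0 : ℝ) ≤ 1 / 2) (by norm_num : (0 : ℝ) ≤ 1 / 2)
    (by norm_num))
  have heq : ‖p - z‖ = ‖q - z‖ := le_antisymm (hmin q hq) (hqmin p hp)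
  have hpar := parallelogram_law_with_norm ℝ (p - z) (q - z)
  have e1 : (1 / 2 : ℝ) • p + (1 / 2 : ℝ) • q - z = (1 / 2 : ℝ) • ((p - z) + (q - z)) := by
    module
  have e2 : (p - z) - (q - z) = p - q := by abel
  rw [e1, norm_smul] at hmid
  rw [e2, ← heq] at hpar
  norm_num at hmid
  have h0 : ‖p - q‖ = 0 := by
    nlinarith [norm_nonneg (p - q), norm_nonneg (p - z), norm_nonneg ((p - z) + (q - z))]
  exact sub_eq_zero.mp (norm_eq_zero.mp h0)

/-- The sequence `k ↦ c / (k + Γ) ^ p` (real power). -/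
def powSeq (c Γ p : ℝ) (k : ℕ) : ℝ := c / ((k : ℝ) + Γ) ^ p

/-- `x k i` (for `k ≥ 0` and `1 ≤ i ≤ m + 1`) are the agents' iterates of the projected iteratively
regularized incremental gradient method with agents `1, …, m`, stepsizes `γ k` and regularization
parameters `η k`, started at an arbitrary point of `X`.  The point `x k 1` is also written
`x_k`. -/
structure IsPairIG {n : ℕ} (m : ℕ) (X : Set (EuclideanSpace ℝ (Fin n)))
    (f : ℕ → EuclideanSpace ℝ (Fin n) → ℝ)
    (F : ℕ → EuclideanSpace ℝ (Fin n) → EuclideanSpace ℝ (Fin n))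
    (γ η : ℕ → ℝ) (x : ℕ → ℕ → EuclideanSpace ℝ (Fin n)) : Prop where
  init_mem : x 0 1 ∈ X
  step : ∀ k, ∀ i ∈ Finset.Icc 1 m,
    x k (i + 1) = euclProj X (x k i - γ k • (F i (x k i) + η k • ∇ (f i) (x k i)))
  next : ∀ k, x (k + 1) 1 = x k (m + 1)

/-- The regularized mapping `∑ i = 1, …, m, (F i + η ∇ f i)`. -/
def regMap {n : ℕ} (m : ℕ) (f : ℕ → EuclideanSpace ℝ (Fin n) → ℝ)
    (F : ℕ → EuclideanSpace ℝ (Fin n) → EuclideanSpace ℝ (Fin n)) (η : ℝ)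
    (x : EuclideanSpace ℝ (Fin n)) : EuclideanSpace ℝ (Fin n) :=
  ∑ i ∈ Finset.Icc 1 m, (F i x + η • ∇ (f i) x)

/-- The constant `B₀`. -/
def constB₀ (m : ℕ) (CF Cf μmin γ η Γ a b : ℝ) : ℝ :=
  1.5 * Cf ^ 2 / ((m : ℝ) ^ 2 * μmin ^ 3 * γ ^ 3 * η * Γ ^ (2 - 3 * a - b))
    + (CF + powSeq η Γ b 0 * Cf) ^ 2

/-- The constant `τ`; its first argument `d` is the distance `‖x_1 - x*_{η_0}‖`. -/
def constτ (d : ℝ) (m : ℕ) (CF Cf μmin γ η Γ a b : ℝ) : ℝ :=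
  max (μmin * η * γ⁻¹ * (constB₀ m CF Cf μmin γ η Γ a b)⁻¹ * Γ ^ (a - b) * d ^ 2) 2

end

/-! Write `t = k + Γ`, `s = γ_k η_k μmin`, `C = CF + η_0 Cf`. One pass is a perturbed projected step
for the regularized sum. Evaluating the mappings at the Tikhonov point `x*_{η_k}`, where the
variational inequality gives a sign, yields `‖x_{k+1} - x*_{η_k}‖² ≤ (1 - 2s) ‖x_k - x*_{η_k}‖² +
γ_k² C²` (`incremental_pass_le`).

The target itself moves: `tikhonov_dist_le` bounds its displacement by a multiple of the relative
change of `η_k`, which is at most `1 / t`. Young's inequality spends half of the contraction to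
replace `x*_{η_k}` by `x*_{η_{k-1}}` on the right, at a cost of order (displacement)² / s. As `3a +
b < 2`, this cost is again `O(γ_k²)`, and the two errors add up to at most `γ_k² B₀`.

The resulting recursion has contraction factor `1 - s` and error `γ_k² B₀`, whose ratio to `s` has
order `t ^ (-(a - b))`. That power varies slowly compared with `s`, so the rate propagates by
induction (`contraction_rate_step`). The inner iterates stay within `(i - 1) γ_{k+1} C / m` of the
start of their pass.

Existence of the Tikhonov points combines Sion's minimax theorem, compactness and Minty's lemma;
strong monotonicity gives uniqueness. -/

/-! ### Projections and gradients of strongly convex functions -/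

theorem norm_euclProj_sub_le {n : ℕ} {X : Set (EuclideanSpace ℝ (Fin n))} (hcl : IsClosed X)
    (hX : Convex ℝ X) {y : EuclideanSpace ℝ (Fin n)} (hy : y ∈ X)
    (z : EuclideanSpace ℝ (Fin n)) : ‖euclProj X z - y‖ ≤ ‖z - y‖ := by
  obtain ⟨hp, hmin⟩ := euclProj_spec ⟨y, hy⟩ hcl z
  set p := euclProj X z
  have : Nonempty X := ⟨⟨y, hy⟩⟩
  have hinf : ‖z - p‖ = ⨅ w : X, ‖z - w‖ := by
    refine le_antisymm (le_ciInf fun w => ?_) (ciInf_le ⟨0, ?_⟩ (⟨p, hp⟩ : X))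
    · rw [norm_sub_rev z, norm_sub_rev z]; exact hmin w w.2
    · rintro _ ⟨w, rfl⟩; exact norm_nonneg _
  have hvar := (norm_eq_iInf_iff_real_inner_le_zero hX hp).1 hinf y hy
  have hexp : ‖z - y‖ ^ 2 = ‖z - p‖ ^ 2 - 2 * ⟪z - p, y - p⟫_ℝ + ‖p - y‖ ^ 2 := by
    rw [show z - y = (z - p) - (y - p) by abel, norm_sub_sq_real, norm_sub_rev y p]
  refine le_of_sq_le_sq ?_ (norm_nonneg _)
  nlinarith [sq_nonneg ‖z - p‖]

/-- Divide the strong convexity inequality on the segment from `x` to `y` by `t` and let `t`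
decrease to `0`. -/
theorem StrongConvexOn.inner_gradient_le {n : ℕ} {X : Set (EuclideanSpace ℝ (Fin n))} {μ : ℝ}
    {f : EuclideanSpace ℝ (Fin n) → ℝ} (hf : StrongConvexOn X μ f)
    {x y : EuclideanSpace ℝ (Fin n)} (hx : x ∈ X) (hy : y ∈ X) (hd : DifferentiableAt ℝ f x) :
    ⟪∇ f x, y - x⟫_ℝ + μ / 2 * ‖y - x‖ ^ 2 ≤ f y - f x := by
  have hder : HasDerivAt (fun t : ℝ => f (x + t • (y - x))) ⟪∇ f x, y - x⟫_ℝ 0 := by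
    have h1 : HasFDerivAt f (InnerProductSpace.toDual ℝ _ (∇ f x)) (x + (0 : ℝ) • (y - x)) := by
      simpa using hd.hasGradientAt.hasFDerivAt
    have h2 : HasDerivAt (fun t : ℝ => x + t • (y - x)) (y - x) 0 := by
      simpa using ((hasDerivAt_id (0 : ℝ)).smul_const (y - x)).const_add x
    have h3 := h1.comp_hasDerivAt 0 h2
    rwa [InnerProductSpace.toDual_apply_apply] at h3
  have hslope := hasDerivWithinAt_iff_tendsto_slope.1 (hder.hasDerivWithinAt (s := Set.Ioi 0))
  have hs : (Set.Ioi (0 : ℝ)) \ {0} = Set.Ioi 0 := by simp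
  rw [hs] at hslope
  have hright : Filter.Tendsto (fun t : ℝ => f y - f x - (1 - t) * (μ / 2 * ‖y - x‖ ^ 2))
      (nhdsWithin 0 (Set.Ioi 0)) (nhds (f y - f x - (1 - 0) * (μ / 2 * ‖y - x‖ ^ 2))) := by
    refine Filter.Tendsto.mono_left (Continuous.tendsto ?_ 0) nhdsWithin_le_nhds
    fun_prop
  have hle : ⟪∇ f x, y - x⟫_ℝ ≤ f y - f x - (1 - 0) * (μ / 2 * ‖y - x‖ ^ 2) := by
    refine le_of_tendsto_of_tendsto hslope hright ?_
    have hmem : Set.Ioo (0 : ℝ) 1 ∈ nhdsWithin (0 : ℝ) (Set.Ioi 0) :=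
      Ioo_mem_nhdsGT zero_lt_one
    filter_upwards [hmem] with t ht
    have hc := hf.2 hy hx ht.1.le (sub_nonneg.2 ht.2.le) (by ring)
    have e : t • y + (1 - t) • x = x + t • (y - x) := by module
    rw [e] at hc
    simp only [smul_eq_mul] at hc
    rw [slope_def_field, sub_zero, zero_smul, add_zero, div_le_iff₀ ht.1]
    nlinarith
  linarith

theorem StrongConvexOn.inner_gradient_sub_ge {n : ℕ} {X : Set (EuclideanSpace ℝ (Fin n))} {μ : ℝ}
    {f : EuclideanSpace ℝ (Fin n) → ℝ} (hf : StrongConvexOn X μ f)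
    {x y : EuclideanSpace ℝ (Fin n)} (hx : x ∈ X) (hy : y ∈ X) (hdx : DifferentiableAt ℝ f x)
    (hdy : DifferentiableAt ℝ f y) : μ * ‖x - y‖ ^ 2 ≤ ⟪∇ f x - ∇ f y, x - y⟫_ℝ := by
  have h1 := hf.inner_gradient_le hx hy hdx
  have h2 := hf.inner_gradient_le hy hx hdy
  rw [← neg_sub x y, inner_neg_right, norm_neg] at h1
  rw [inner_sub_left]
  linarith

theorem ContDiffAt.continuousAt_gradient {n : ℕ} {f : EuclideanSpace ℝ (Fin n) → ℝ}
    {x : EuclideanSpace ℝ (Fin n)} (hf : ContDiffAt ℝ 1 f x) : ContinuousAt (∇ f) x :=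
  (InnerProductSpace.toDual ℝ (EuclideanSpace ℝ (Fin n))).symm.continuous.continuousAt.comp
    (hf.continuousAt_fderiv one_ne_zero)

/-! ### Existence of solutions of monotone variational inequalities -/

/-- The dual (Minty) variational inequality of a monotone map has a solution for every finite set
of test points. -/
theorem MonotoneMapOn.exists_finset_dual {n : ℕ} {X : Set (EuclideanSpace ℝ (Fin n))}
    {G : EuclideanSpace ℝ (Fin n) → EuclideanSpace ℝ (Fin n)} (hne : X.Nonempty)
    (hX : Convex ℝ X) (hc : IsCompact X) (hG : MonotoneMapOn X G) (u : Finset X) :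
    ∃ x ∈ X, ∀ y ∈ u, 0 ≤ ⟪G y, (y : EuclideanSpace ℝ (Fin n)) - x⟫_ℝ := by
  rcases u.eq_empty_or_nonempty with rfl | hu
  · obtain ⟨x, hx⟩ := hne
    exact ⟨x, hx, by simp⟩
  have : Nonempty u := hu.to_subtype
  let pt : u → EuclideanSpace ℝ (Fin n) := fun j => ((j : X) : EuclideanSpace ℝ (Fin n))
  have hpt : ∀ j, pt j ∈ X := fun j => (j : X).2
  -- A zero-sum game: `x` plays against a mixture `w` of the test points. The payoff is affine in
  -- each variable, so Sion's theorem gives a saddle point.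
  let φ : EuclideanSpace ℝ (Fin n) → (u → ℝ) → ℝ := fun x w => ∑ j, w j * ⟪G (pt j), x - pt j⟫_ℝ
  obtain ⟨x, hx, w, hw, hsad⟩ := Sion.exists_isSaddlePointOn (X := X) (Y := stdSimplex ℝ u)
    (f := φ) hne hX hc
    (fun w _ => Continuous.lowerSemicontinuous (by fun_prop) |>.lowerSemicontinuousOn _)
    (fun w _ => by
      refine ConvexOn.quasiconvexOn ⟨hX, fun p _ q _ s t _ _ hst => le_of_eq ?_⟩
      simp only [φ, smul_eq_mul, Finset.mul_sum, ← Finset.sum_add_distrib]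
      refine Finset.sum_congr rfl fun j _ => ?_
      have e : s • p + t • q - pt j = s • (p - pt j) + t • (q - pt j) := by
        rw [show t = 1 - s by linarith]; module
      rw [e, inner_add_right, inner_smul_right, inner_smul_right]
      ring)
    (convex_stdSimplex ℝ u) ⟨_, single_mem_stdSimplex ℝ (Classical.arbitrary u)⟩
    (isCompact_stdSimplex ℝ u)
    (fun x _ => Continuous.upperSemicontinuous (by fun_prop) |>.upperSemicontinuousOn _)
    (fun x _ => by
      refine ConcaveOn.quasiconcaveOn ⟨convex_stdSimplex ℝ u, fun p _ q _ s t _ _ _ => le_of_eq ?_⟩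
      simp only [φ, smul_eq_mul, Finset.mul_sum, ← Finset.sum_add_distrib, Pi.add_apply,
        Pi.smul_apply]
      exact Finset.sum_congr rfl fun j _ => by ring)
  refine ⟨x, hx, fun y hy => ?_⟩
  have hbar : ∑ i, w i • pt i ∈ X := hX.sum_mem (fun i _ => hw.1 i) hw.2 fun i _ => hpt i
  have hsum : φ (∑ i, w i • pt i) w = ∑ j, ∑ i, w j * w i * ⟪G (pt j), pt i - pt j⟫_ℝ := by
    refine Finset.sum_congr rfl fun j _ => ?_
    have e : ∑ i, w i • pt i - pt j = ∑ i, w i • (pt i - pt j) := by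
      simp only [smul_sub, Finset.sum_sub_distrib, ← Finset.sum_smul, hw.2, one_smul]
    rw [e, inner_sum, Finset.mul_sum]
    exact Finset.sum_congr rfl fun i _ => by rw [inner_smul_right]; ring
  -- Against `w`, its own barycentre has payoff at most `0`: adding the double sum to its transpose
  -- pairs the terms so that monotonicity applies.
  have hneg : φ (∑ i, w i • pt i) w ≤ 0 := by
    have hswap := Finset.sum_comm (s := Finset.univ) (t := Finset.univ)
      (f := fun j i => w j * w i * ⟪G (pt j), pt i - pt j⟫_ℝ)
    have hadd : (∑ j, ∑ i, w j * w i * ⟪G (pt j), pt i - pt j⟫_ℝ)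
        + ∑ j, ∑ i, w i * w j * ⟪G (pt i), pt j - pt i⟫_ℝ ≤ 0 := by
      simp only [← Finset.sum_add_distrib]
      refine Finset.sum_nonpos fun j _ => Finset.sum_nonpos fun i _ => ?_
      have hm := hG _ (hpt j) _ (hpt i)
      have hww : 0 ≤ w j * w i := mul_nonneg (hw.1 j) (hw.1 i)
      have e : w j * w i * ⟪G (pt j), pt i - pt j⟫_ℝ + w i * w j * ⟪G (pt i), pt j - pt i⟫_ℝ
          = -(w j * w i * ⟪G (pt j) - G (pt i), pt j - pt i⟫_ℝ) := by
        rw [inner_sub_left, ← neg_sub (pt j) (pt i), inner_neg_right]; ring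
      rw [e]
      exact neg_nonpos.2 (mul_nonneg hww hm)
    rw [hsum]
    linarith
  -- The saddle inequality compares the vertex of the simplex at `y` with the barycentre.
  have hle := hsad _ hbar _ (single_mem_stdSimplex ℝ (⟨y, hy⟩ : u))
  have hval : φ x (Pi.single (⟨y, hy⟩ : u) 1) = ⟪G y, x - y⟫_ℝ := by
    simp [φ, pt, Pi.single_apply]
  rw [hval] at hle
  rw [← neg_sub, inner_neg_right]
  linarith

/-- Minty's lemma: a solution of the dual variational inequality is a solution. -/
theorem mem_VISol_of_dual {n : ℕ} {X : Set (EuclideanSpace ℝ (Fin n))}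
    {G : EuclideanSpace ℝ (Fin n) → EuclideanSpace ℝ (Fin n)}
    (hX : Convex ℝ X) (hcont : ContinuousOn G X) {x : EuclideanSpace ℝ (Fin n)} (hx : x ∈ X)
    (hdual : ∀ y ∈ X, 0 ≤ ⟪G y, y - x⟫_ℝ) : x ∈ VISol X G := by
  refine ⟨hx, fun y hy => ?_⟩
  have hseg : ∀ t ∈ Set.Icc (0 : ℝ) 1, x + t • (y - x) ∈ X := fun t ht => by
    have := hX hx hy (sub_nonneg.2 ht.2) ht.1 (by ring)
    rwa [show (1 - t) • x + t • y = x + t • (y - x) by module] at this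
  have hc : ContinuousOn (fun t : ℝ => ⟪G (x + t • (y - x)), y - x⟫_ℝ) (Set.Icc 0 1) := by
    have : ContinuousOn (fun t : ℝ => G (x + t • (y - x))) (Set.Icc 0 1) :=
      hcont.comp (Continuous.continuousOn (by fun_prop)) hseg
    exact this.inner continuousOn_const
  have h0 : Filter.Tendsto (fun t : ℝ => ⟪G (x + t • (y - x)), y - x⟫_ℝ)
      (nhdsWithin 0 (Set.Ioo 0 1)) (nhds ⟪G x, y - x⟫_ℝ) := by
    have := (hc 0 (by simp)).mono_left (nhdsWithin_mono 0 Set.Ioo_subset_Icc_self)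
    simpa using this
  rw [nhdsWithin_Ioo_eq_nhdsGT zero_lt_one] at h0
  refine ge_of_tendsto h0 ?_
  -- Testing the dual inequality at `x + t • (y - x)` leaves a factor `t > 0` to cancel; continuity
  -- then handles `t → 0`.
  filter_upwards [Ioo_mem_nhdsGT (zero_lt_one (α := ℝ))] with t ht
  have h := hdual _ (hseg t ⟨ht.1.le, ht.2.le⟩)
  rw [add_sub_cancel_left, inner_smul_right] at h
  exact nonneg_of_mul_nonneg_right h ht.1

/-- Each test point cuts out a closed half-space or the whole space, so compactness upgrades
finitely many test points to all of them. -/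
theorem MonotoneMapOn.nonempty_VISol {n : ℕ} {X : Set (EuclideanSpace ℝ (Fin n))}
    {G : EuclideanSpace ℝ (Fin n) → EuclideanSpace ℝ (Fin n)} (hne : X.Nonempty)
    (hX : Convex ℝ X) (hc : IsCompact X) (hG : MonotoneMapOn X G) (hcont : ContinuousOn G X) :
    (VISol X G).Nonempty := by
  obtain ⟨x, hx, hx'⟩ := hc.inter_iInter_nonempty
    (fun y : X => {x | 0 ≤ ⟪G y, (y : EuclideanSpace ℝ (Fin n)) - x⟫_ℝ})
    (fun y => isClosed_le continuous_const (by fun_prop)) (fun u => by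
      obtain ⟨x, hx, h⟩ := hG.exists_finset_dual hne hX hc u
      exact ⟨x, hx, by simpa using h⟩)
  rw [Set.mem_iInter] at hx'
  exact ⟨x, mem_VISol_of_dual hX hcont hx fun y hy => hx' ⟨y, hy⟩⟩

/-! ### One pass of the incremental method -/

/-- A full pass of the projected incremental method contracts towards the solution of the
variational inequality of the sum, up to a second order error in the stepsize. -/
theorem incremental_pass_le {n m : ℕ} {X : Set (EuclideanSpace ℝ (Fin n))}
    {z : ℕ → EuclideanSpace ℝ (Fin n)}
    {g : ℕ → EuclideanSpace ℝ (Fin n) → EuclideanSpace ℝ (Fin n)} {s t c : ℝ}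
    (ht : 0 ≤ t) (hcl : IsClosed X) (hX : Convex ℝ X)
    (hmono : ∀ i ∈ Finset.Icc 1 m, ∀ p ∈ X, ∀ q ∈ X, s * ‖p - q‖ ^ 2 ≤ ⟪g i p - g i q, p - q⟫_ℝ)
    (hbd : ∀ i ∈ Finset.Icc 1 m, ∀ p ∈ X, ‖g i p‖ ≤ c)
    (hzX : ∀ i ∈ Finset.Icc 1 m, z i ∈ X)
    (hz : ∀ i ∈ Finset.Icc 1 m, z (i + 1) = euclProj X (z i - t • g i (z i)))
    (hdist : ∀ i ∈ Finset.Icc 1 m, ‖z i - z 1‖ ≤ ((i : ℝ) - 1) * (t * c))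
    {y : EuclideanSpace ℝ (Fin n)} (hy : y ∈ X) {j : ℕ} (hj : j ≤ m) :
    ‖z (j + 1) - y‖ ^ 2 ≤ ‖z 1 - y‖ ^ 2 - 2 * t * ⟪∑ i ∈ Finset.Icc 1 j, g i y, z 1 - y⟫_ℝ
      - 2 * t * s * ∑ i ∈ Finset.Icc 1 j, ‖z i - y‖ ^ 2 + (j : ℝ) ^ 2 * (t * c) ^ 2 := by
  induction j with
  | zero => simp
  | succ j ih =>
    have ih := ih (by omega)
    have hmem : j + 1 ∈ Finset.Icc 1 m := Finset.mem_Icc.2 ⟨by omega, hj⟩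
    rw [Finset.sum_Icc_succ_top (by omega), Finset.sum_Icc_succ_top (by omega), inner_add_left,
      hz _ hmem]
    set w := z (j + 1)
    have hw : w ∈ X := hzX _ hmem
    have hc := hbd _ hmem _ hw
    have hcy := hbd _ hmem _ hy
    have hproj := norm_euclProj_sub_le hcl hX hy (w - t • g (j + 1) w)
    have hexp : ‖w - t • g (j + 1) w - y‖ ^ 2
        = ‖w - y‖ ^ 2 - 2 * t * ⟪g (j + 1) w, w - y⟫_ℝ + t ^ 2 * ‖g (j + 1) w‖ ^ 2 := by
      rw [show w - t • g (j + 1) w - y = (w - y) - t • g (j + 1) w by abel, norm_sub_sq_real,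
        inner_smul_right, norm_smul, mul_pow, Real.norm_eq_abs, sq_abs, real_inner_comm]
      ring
    have hsq : ‖euclProj X (w - t • g (j + 1) w) - y‖ ^ 2 ≤ ‖w - t • g (j + 1) w - y‖ ^ 2 :=
      pow_le_pow_left₀ (norm_nonneg _) hproj 2
    have hm := hmono _ hmem _ hw _ hy
    rw [inner_sub_left] at hm
    have hd := hdist _ hmem
    -- Pairing with `z 1 - y` instead of `w - y` lets the values at `y` add up to a sum; the lag
    -- costs `2 j (t c)²`, which with the step's own `(t c)²` turns `j²` into `(j + 1)²`.
    have hcs : -(c * ((j : ℝ) * (t * c))) ≤ ⟪g (j + 1) y, w - z 1⟫_ℝ := by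
      have h1 := (abs_le.1 (abs_real_inner_le_norm (g (j + 1) y) (w - z 1))).1
      have h2 : ‖g (j + 1) y‖ * ‖w - z 1‖ ≤ c * ((j : ℝ) * (t * c)) := by
        push_cast at hd
        rw [add_sub_cancel_right] at hd
        exact mul_le_mul hcy hd (norm_nonneg _) ((norm_nonneg _).trans hcy)
      linarith
    have hsplit : ⟪g (j + 1) y, w - y⟫_ℝ
        = ⟪g (j + 1) y, z 1 - y⟫_ℝ + ⟪g (j + 1) y, w - z 1⟫_ℝ := by
      rw [← inner_add_right]; congr 1; abel
    have hg2 : ‖g (j + 1) w‖ ^ 2 ≤ c ^ 2 := pow_le_pow_left₀ (norm_nonneg _) hc 2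
    have hk : s * ‖w - y‖ ^ 2 + ⟪g (j + 1) y, z 1 - y⟫_ℝ - c * ((j : ℝ) * (t * c))
        ≤ ⟪g (j + 1) w, w - y⟫_ℝ := by linarith
    have hk2 := mul_le_mul_of_nonneg_left hk (mul_nonneg zero_le_two ht)
    have hk3 := mul_le_mul_of_nonneg_left hg2 (sq_nonneg t)
    push_cast
    linear_combination hsq + hexp + ih + hk2 + hk3

/-- Within one pass of the projected incremental method each step moves at most by the stepsize
times the bound on the mappings. -/
theorem incremental_dist_le {n m : ℕ} {X : Set (EuclideanSpace ℝ (Fin n))}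
    {z : ℕ → EuclideanSpace ℝ (Fin n)}
    {g : ℕ → EuclideanSpace ℝ (Fin n) → EuclideanSpace ℝ (Fin n)} {t c : ℝ}
    (ht : 0 ≤ t) (hcl : IsClosed X) (hX : Convex ℝ X)
    (hbd : ∀ i ∈ Finset.Icc 1 m, ∀ p ∈ X, ‖g i p‖ ≤ c)
    (hzX : ∀ i ∈ Finset.Icc 1 m, z i ∈ X)
    (hz : ∀ i ∈ Finset.Icc 1 m, z (i + 1) = euclProj X (z i - t • g i (z i)))
    {i : ℕ} (hi : i ∈ Finset.Icc 1 m) : ‖z i - z 1‖ ≤ ((i : ℝ) - 1) * (t * c) := by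
  obtain ⟨h1, hm⟩ := Finset.mem_Icc.1 hi
  clear hi
  induction i, h1 using Nat.le_induction with
  | base => simp
  | succ i h1 ih =>
    have hmem : i ∈ Finset.Icc 1 m := Finset.mem_Icc.2 ⟨h1, by omega⟩
    have hstep : ‖z (i + 1) - z i‖ ≤ t * c := by
      rw [hz i hmem]
      refine (norm_euclProj_sub_le hcl hX (hzX i hmem) _).trans ?_
      rw [sub_sub_cancel_left, norm_neg, norm_smul, Real.norm_of_nonneg ht]
      exact mul_le_mul_of_nonneg_left (hbd i hmem _ (hzX i hmem)) ht
    have := norm_sub_le_norm_sub_add_norm_sub (z (i + 1)) (z i) (z 1)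
    have := ih (by omega)
    push_cast
    linarith

theorem IsPairIG.mem {n m : ℕ} {X : Set (EuclideanSpace ℝ (Fin n))}
    {f : ℕ → EuclideanSpace ℝ (Fin n) → ℝ}
    {F : ℕ → EuclideanSpace ℝ (Fin n) → EuclideanSpace ℝ (Fin n)} {γ η : ℕ → ℝ}
    {x : ℕ → ℕ → EuclideanSpace ℝ (Fin n)} (hx : IsPairIG m X f F γ η x) (hcl : IsClosed X)
    (k : ℕ) {i : ℕ} (hi : i ∈ Finset.Icc 1 (m + 1)) : x k i ∈ X := by
  have key : ∀ k, x k 1 ∈ X → ∀ i, 1 ≤ i → i ≤ m + 1 → x k i ∈ X := by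
    intro k hk i h1 hm
    induction i, h1 using Nat.le_induction with
    | base => exact hk
    | succ i h1 ih =>
      rw [hx.step k i (Finset.mem_Icc.2 ⟨h1, by omega⟩)]
      exact (euclProj_spec ⟨_, hk⟩ hcl _).1
  have hfirst : ∀ k, x k 1 ∈ X := by
    intro k
    induction k with
    | zero => exact hx.init_mem
    | succ k ih =>
      rw [hx.next]
      exact key k ih _ (by omega) le_rfl
  exact key k (hfirst k) i (Finset.mem_Icc.1 hi).1 (Finset.mem_Icc.1 hi).2

/-! ### Drift of the Tikhonov trajectory -/

/-- Distance between the Tikhonov solutions for two regularization parameters. -/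
theorem tikhonov_dist_le {n : ℕ} {X : Set (EuclideanSpace ℝ (Fin n))}
    {G H : EuclideanSpace ℝ (Fin n) → EuclideanSpace ℝ (Fin n)} {η η' σ C δ : ℝ}
    (hG : MonotoneMapOn X G)
    (hH : ∀ p ∈ X, ∀ q ∈ X, σ * ‖p - q‖ ^ 2 ≤ ⟪H p - H q, p - q⟫_ℝ)
    (hη : 0 < η) (hη' : η ≤ η') (hδ : η' - η ≤ η * δ)
    (hC : ∀ p ∈ X, ‖H p‖ ≤ C) {u v : EuclideanSpace ℝ (Fin n)}
    (hu : u ∈ VISol X fun p => G p + η • H p) (hv : v ∈ VISol X fun p => G p + η' • H p) :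
    σ * ‖u - v‖ ≤ C * δ := by
  have h1 := hu.2 v hv.1
  have h2 := hv.2 u hu.1
  have h3 := hG u hu.1 v hv.1
  have h4 := mul_le_mul_of_nonneg_left (hH u hu.1 v hv.1) hη.le
  have hC0 : 0 ≤ C := (norm_nonneg _).trans (hC u hu.1)
  have hδ0 : 0 ≤ δ := by
    by_contra! h
    nlinarith
  have h5 : (η' - η) * ⟪H v, u - v⟫_ℝ ≤ η * δ * (C * ‖u - v‖) := by
    have h6 : ⟪H v, u - v⟫_ℝ ≤ C * ‖u - v‖ := (real_inner_le_norm _ _).trans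
      (mul_le_mul_of_nonneg_right (hC v hv.1) (norm_nonneg _))
    exact (mul_le_mul_of_nonneg_left h6 (sub_nonneg.2 hη')).trans
      (mul_le_mul_of_nonneg_right hδ (mul_nonneg hC0 (norm_nonneg _)))
  rw [← neg_sub u v, inner_neg_right, inner_add_left, inner_smul_left] at h1
  rw [inner_add_left, inner_smul_left] at h2
  rw [inner_sub_left] at h3 h4
  simp only [conj_trivial] at h1 h2
  -- Adding the two variational inequalities and dropping the monotone part leaves `η ⟪H u - H v, u
  -- - v⟫ ≤ (η' - η) ⟪H v, u - v⟫`. The change is measured relative to `η`, so `η` cancels.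
  have h7 : η * (‖u - v‖ * (σ * ‖u - v‖)) ≤ η * (‖u - v‖ * (C * δ)) := by nlinarith
  have h8 := le_of_mul_le_mul_left h7 hη
  rcases (norm_nonneg (u - v)).eq_or_lt with h | h
  · rw [← h, mul_zero]; positivity
  · exact le_of_mul_le_mul_left h8 h

/-! ### Scalar recursion and power sequences -/

/-- A form of Bernoulli's inequality. -/
theorem rpow_le_one_add_mul_rpow_sub_one {t p : ℝ} (ht : 2 ≤ t) (hp0 : 0 ≤ p) (hp1 : p ≤ 1) :
    t ^ p ≤ (1 + 2 * p / t) * (t - 1) ^ p := by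
  have h1 : 0 < t - 1 := by linarith
  have ht0 : 0 < t := by linarith
  have e : t = (1 + 1 / (t - 1)) * (t - 1) := by field_simp; ring
  have hb : (1 + 1 / (t - 1)) ^ p ≤ 1 + p * (1 / (t - 1)) :=
    rpow_one_add_le_one_add_mul_self (by have := one_div_pos.2 h1; linarith) hp0 hp1
  have h2 : p * (1 / (t - 1)) ≤ 2 * p / t := by
    rw [mul_one_div, div_le_div_iff₀ h1 ht0]
    nlinarith
  calc t ^ p = (1 + 1 / (t - 1)) ^ p * (t - 1) ^ p := by
        rw [← Real.mul_rpow (by positivity) h1.le, ← e]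
    _ ≤ _ := mul_le_mul_of_nonneg_right (by linarith) (Real.rpow_nonneg h1.le _)

theorem div_rpow_sub_one_le {t p K : ℝ} (hK : 0 ≤ K) (ht : 2 ≤ t) (hp0 : 0 ≤ p) (hp1 : p ≤ 1) :
    K / (t - 1) ^ p ≤ K / t ^ p * (1 + 2 * p / t) := by
  have h1 : 0 < (t - 1) ^ p := Real.rpow_pos_of_pos (by linarith) _
  have h2 : 0 < t ^ p := Real.rpow_pos_of_pos (by linarith) _
  rw [div_mul_eq_mul_div, div_le_div_iff₀ h1 h2, mul_assoc]
  exact mul_le_mul_of_nonneg_left (rpow_le_one_add_mul_rpow_sub_one ht hp0 hp1) hK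

/-- The induction step for a recursion with contraction factor `1 - κ / t ^ (a + b)`. -/
theorem contraction_rate_step {t a b κ K e e' r : ℝ} (ht : 2 ≤ t) (hb : 0 < b) (hab : b < a) (hab1 : a + b < 1) (hκ : 0 < κ) (hκt : 4 / κ ≤ t ^ (1 - a - b))
    (hK : 0 ≤ K) (hs : κ / t ^ (a + b) ≤ 1) (he : e ≤ K / (t - 1) ^ (a - b))
    (he' : e' ≤ (1 - κ / t ^ (a + b)) * e + r)
    (hr : r ≤ κ / t ^ (a + b) * (K / 2 / t ^ (a - b))) : e' ≤ K / t ^ (a - b) := by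
  have ht0 : 0 < t := by linarith
  set s := κ / t ^ (a + b) with hsdef
  have hs0 : 0 < s := div_pos hκ (Real.rpow_pos_of_pos ht0 _)
  have hb1 := he.trans (div_rpow_sub_one_le hK ht (sub_nonneg.2 hab.le) (by linarith))
  have hQ : 0 ≤ K / t ^ (a - b) := div_nonneg hK (Real.rpow_nonneg ht0.le _)
  have hst : 4 / t ≤ s := by
    rw [hsdef, div_le_div_iff₀ ht0 (Real.rpow_pos_of_pos ht0 _)]
    have h4 : 4 ≤ t ^ (1 - a - b) * κ := by rwa [div_le_iff₀ hκ] at hκt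
    have e1 : t ^ (1 - a - b) * t ^ (a + b) = t := by
      rw [← Real.rpow_add ht0]; ring_nf; exact Real.rpow_one t
    calc 4 * t ^ (a + b) ≤ t ^ (1 - a - b) * κ * t ^ (a + b) :=
          mul_le_mul_of_nonneg_right h4 (Real.rpow_nonneg ht0.le _)
      _ = κ * (t ^ (1 - a - b) * t ^ (a + b)) := by ring
      _ = κ * t := by rw [e1]
  have hp : 2 * (a - b) / t ≤ s / 2 := by
    have : 2 * (a - b) / t ≤ 2 / t := by gcongr; linarith
    have e4 : 4 / t = 2 * (2 / t) := by ring
    linarith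
  have hq0 : 0 ≤ 2 * (a - b) / t := div_nonneg (by linarith) ht0.le
  have e2 : K / 2 / t ^ (a - b) = K / t ^ (a - b) / 2 := by ring
  rw [e2] at hr
  set Q := K / t ^ (a - b)
  have h5 := mul_le_mul_of_nonneg_left hb1 (sub_nonneg.2 hs)
  -- The growth `2(a - b)/t` of the rate is at most `s / 2`, and the new error takes another `s /
  -- 2`; the contraction `s` pays for both.
  have h6 : (1 - s) * (1 + 2 * (a - b) / t) + s / 2 ≤ 1 := by nlinarith
  have h7 := mul_le_mul_of_nonneg_left h6 hQ
  nlinarith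

/-- Young's inequality with weight `s`: `(1 - 2s)(1 + s) ≤ 1 - s` and `(1 - 2s)(1 + 1/s) ≤ 1/s`, so
the constant `1.5` has room to spare. -/
theorem one_sub_two_mul_mul_sq_le {s w p d : ℝ} (hs : 0 < s) (hs1 : s ≤ 1 / 2) (hw0 : 0 ≤ w)
    (hw : w ≤ p + d) : (1 - 2 * s) * w ^ 2 ≤ (1 - s) * p ^ 2 + 1.5 * d ^ 2 / s := by
  have h1 : w ^ 2 ≤ (p + d) ^ 2 := pow_le_pow_left₀ hw0 hw 2
  have h2 := mul_le_mul_of_nonneg_left h1 (by linarith : 0 ≤ 1 - 2 * s)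
  refine h2.trans ?_
  have h3 : (p + d) ^ 2 ≤ (1 + s) * p ^ 2 + (1 + 1 / s) * d ^ 2 := by
    have e : (1 + s) * p ^ 2 + (1 + 1 / s) * d ^ 2 - (p + d) ^ 2 = (s * p - d) ^ 2 / s := by
      field_simp; ring
    have : 0 ≤ (s * p - d) ^ 2 / s := by positivity
    linarith
  refine (mul_le_mul_of_nonneg_left h3 (by linarith : 0 ≤ 1 - 2 * s)).trans ?_
  have e : (1 - s) * p ^ 2 + 1.5 * d ^ 2 / s
      - (1 - 2 * s) * ((1 + s) * p ^ 2 + (1 + 1 / s) * d ^ 2)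
      = 2 * s ^ 2 * p ^ 2 + (1 / 2 + s + 2 * s ^ 2) * d ^ 2 / s := by
    field_simp; ring
  have : 0 ≤ 2 * s ^ 2 * p ^ 2 + (1 / 2 + s + 2 * s ^ 2) * d ^ 2 / s := by positivity
  linarith

/-- The left side has order `t ^ (a + b - 2) = t ^ (-2a) * t ^ (-(2 - 3a - b))`. Bounding the last
factor by its value at `Γ` produces the first term of `B₀`. -/
theorem tikhonov_drift_le {M C μ γ η Γ a b t d : ℝ} (hM : 0 < M) (hμ : 0 < μ) (hγ : 0 < γ)
    (hη : 0 < η) (hΓ : 0 < Γ) (hab2 : 3 * a + b < 2) (ht : Γ ≤ t) (hd0 : 0 ≤ d)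
    (hd : M * μ * d ≤ C * (1 / t)) :
    1.5 * d ^ 2 / (γ * η * μ / t ^ (a + b))
      ≤ (γ / t ^ a) ^ 2 * (1.5 * C ^ 2 / (M ^ 2 * μ ^ 3 * γ ^ 3 * η * Γ ^ (2 - 3 * a - b))) := by
  have ht0 : 0 < t := hΓ.trans_le ht
  have hpow : Γ ^ (2 - 3 * a - b) ≤ t ^ (2 - 3 * a - b) :=
    Real.rpow_le_rpow hΓ.le ht (by linarith)
  have hmul : t ^ (a + b) * (t ^ a) ^ 2 * t ^ (2 - 3 * a - b) = t ^ 2 := by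
    rw [← Real.rpow_natCast (t ^ a), ← Real.rpow_mul ht0.le, ← Real.rpow_add ht0,
      ← Real.rpow_add ht0, ← Real.rpow_natCast t]
    congr 1; push_cast; ring
  have hΓp : 0 < Γ ^ (2 - 3 * a - b) := Real.rpow_pos_of_pos hΓ _
  have hA : 0 < t ^ (a + b) := Real.rpow_pos_of_pos ht0 _
  have hB : 0 < t ^ a := Real.rpow_pos_of_pos ht0 _
  set P := Γ ^ (2 - 3 * a - b)
  set Q := t ^ (2 - 3 * a - b)
  set A := t ^ (a + b)
  set B := t ^ a
  have hsq : (M * μ * d * t) ^ 2 ≤ C ^ 2 := by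
    refine pow_le_pow_left₀ (by positivity) ?_ 2
    have := mul_le_mul_of_nonneg_right hd ht0.le
    rwa [mul_assoc C, one_div_mul_cancel ht0.ne', mul_one] at this
  have hAB : A * B ^ 2 * P ≤ t ^ 2 := hmul ▸ mul_le_mul_of_nonneg_left hpow (by positivity)
  have e1 : 1.5 * d ^ 2 / (γ * η * μ / A) = 1.5 * (M * μ * d) ^ 2 * (A * B ^ 2 * P)
      / (γ * η * μ ^ 3 * M ^ 2 * B ^ 2 * P) := by field_simp
  have e2 : (γ / B) ^ 2 * (1.5 * C ^ 2 / (M ^ 2 * μ ^ 3 * γ ^ 3 * η * P))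
      = 1.5 * C ^ 2 / (γ * η * μ ^ 3 * M ^ 2 * B ^ 2 * P) := by field_simp
  rw [e1, e2]
  refine div_le_div_of_nonneg_right ?_ (by positivity)
  have := mul_le_mul_of_nonneg_left hAB (by positivity : 0 ≤ (M * μ * d) ^ 2)
  nlinarith

theorem powSeq_pos {c Γ p : ℝ} (hc : 0 < c) (hΓ : 0 < Γ) (k : ℕ) : 0 < powSeq c Γ p k :=
  div_pos hc (Real.rpow_pos_of_pos (by positivity) _)

theorem powSeq_antitone {c Γ p : ℝ} (hc : 0 < c) (hΓ : 0 < Γ) (hp : 0 ≤ p) :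
    Antitone (powSeq c Γ p) := by
  intro j k hjk
  have hj : (0 : ℝ) < (j : ℝ) + Γ := by positivity
  exact div_le_div_of_nonneg_left hc.le (Real.rpow_pos_of_pos hj _)
    (Real.rpow_le_rpow hj.le (by gcongr) hp)

theorem powSeq_sub_succ_le {c Γ p : ℝ} (hc : 0 < c) (hΓ : 1 ≤ Γ) (hp : 0 ≤ p) (hp2 : p ≤ 1 / 2)
    (k : ℕ) : powSeq c Γ p k - powSeq c Γ p (k + 1)
      ≤ powSeq c Γ p (k + 1) * (1 / (((k + 1 : ℕ) : ℝ) + Γ)) := by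
  have hk : (0 : ℝ) ≤ k := k.cast_nonneg
  have ht : 2 ≤ ((k + 1 : ℕ) : ℝ) + Γ := by push_cast; linarith
  have h := div_rpow_sub_one_le hc.le ht hp (by linarith)
  have e : ((k + 1 : ℕ) : ℝ) + Γ - 1 = k + Γ := by push_cast; ring
  rw [e] at h
  have h0 := powSeq_pos (p := p) hc (by linarith : 0 < Γ) (k + 1)
  unfold powSeq at *
  have h1 : 2 * p / (((k + 1 : ℕ) : ℝ) + Γ) ≤ 1 / (((k + 1 : ℕ) : ℝ) + Γ) := by
    gcongr; linarith
  nlinarith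

theorem powSeq_mul_powSeq {c d Γ p q : ℝ} (hΓ : 0 < Γ) (k : ℕ) :
    powSeq c Γ p k * powSeq d Γ q k = c * d / ((k : ℝ) + Γ) ^ (p + q) := by
  have : (0 : ℝ) < (k : ℝ) + Γ := by positivity
  rw [powSeq, powSeq, Real.rpow_add this, div_mul_div_comm]

theorem regMap_eq_add_smul {n : ℕ} (m : ℕ) (f : ℕ → EuclideanSpace ℝ (Fin n) → ℝ)
    (F : ℕ → EuclideanSpace ℝ (Fin n) → EuclideanSpace ℝ (Fin n)) (η : ℝ) :
    regMap m f F η = fun z => ∑ i ∈ Finset.Icc 1 m, F i z + η • ∑ i ∈ Finset.Icc 1 m, ∇ (f i) z := by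
  funext z
  rw [regMap, Finset.sum_add_distrib, Finset.smul_sum]

theorem sum_strongly_monotone {n m : ℕ} {X : Set (EuclideanSpace ℝ (Fin n))}
    {g : ℕ → EuclideanSpace ℝ (Fin n) → EuclideanSpace ℝ (Fin n)} {s : ℝ}
    (hg : ∀ i ∈ Finset.Icc 1 m, ∀ p ∈ X, ∀ q ∈ X, s * ‖p - q‖ ^ 2 ≤ ⟪g i p - g i q, p - q⟫_ℝ) :
    ∀ p ∈ X, ∀ q ∈ X, m * s * ‖p - q‖ ^ 2
      ≤ ⟪∑ i ∈ Finset.Icc 1 m, g i p - ∑ i ∈ Finset.Icc 1 m, g i q, p - q⟫_ℝ := by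
  intro p hp q hq
  rw [← Finset.sum_sub_distrib, sum_inner]
  have := Finset.card_nsmul_le_sum _ _ _ fun i hi => hg i hi p hp q hq
  simpa [nsmul_eq_mul, mul_assoc] using this

/-! ### Unique solvability and the error bound -/

theorem existsUnique_mem_VISol {n : ℕ} {X : Set (EuclideanSpace ℝ (Fin n))}
    {G : EuclideanSpace ℝ (Fin n) → EuclideanSpace ℝ (Fin n)} {s : ℝ} (hs : 0 < s)
    (hne : X.Nonempty) (hX : Convex ℝ X) (hc : IsCompact X)
    (hG : ∀ p ∈ X, ∀ q ∈ X, s * ‖p - q‖ ^ 2 ≤ ⟪G p - G q, p - q⟫_ℝ) (hcont : ContinuousOn G X) :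
    ∃! y, y ∈ VISol X G := by
  have hmono : MonotoneMapOn X G := fun p hp q hq =>
    (by positivity : 0 ≤ s * ‖p - q‖ ^ 2).trans (hG p hp q hq)
  obtain ⟨u, hu⟩ := hmono.nonempty_VISol hne hX hc hcont
  refine ⟨u, hu, fun v hv => ?_⟩
  have h1 := hu.2 v hv.1
  have h2 := hv.2 u hu.1
  have h3 := hG v hv.1 u hu.1
  rw [← neg_sub v u, inner_neg_right] at h2
  rw [inner_sub_left] at h3
  have h4 : ‖v - u‖ ^ 2 ≤ 0 := by
    by_contra! h
    nlinarith [mul_pos hs h]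
  have h5 : ‖v - u‖ = 0 := by nlinarith [norm_nonneg (v - u)]
  exact sub_eq_zero.1 (norm_eq_zero.1 h5)

theorem theorem2 {n m : ℕ} (hm : 1 ≤ m)
    -- the problem data
    (X : Set (EuclideanSpace ℝ (Fin n)))
    (f : ℕ → EuclideanSpace ℝ (Fin n) → ℝ)
    (F : ℕ → EuclideanSpace ℝ (Fin n) → EuclideanSpace ℝ (Fin n))
    (hX_ne : X.Nonempty) (hX_conv : Convex ℝ X) (hX_comp : IsCompact X)
    (hF_cont : ∀ i ∈ Finset.Icc 1 m, ContinuousOn (F i) X)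
    (hF_mono : ∀ i ∈ Finset.Icc 1 m, MonotoneMapOn X (F i))
    (hf_C1 : ∀ i ∈ Finset.Icc 1 m, ∀ z ∈ X, ContDiffAt ℝ 1 (f i) z)
    (μ : ℕ → ℝ) (hμ_pos : ∀ i ∈ Finset.Icc 1 m, 0 < μ i)
    (hf_sc : ∀ i ∈ Finset.Icc 1 m, StrongConvexOn X (μ i) (f i))
    (μmin : ℝ) (hμmin : IsLeast (μ '' Set.Icc 1 m) μmin)
    -- bounds on the mappings and the gradients over `X`
    (CF Cf : ℝ) (hCF_pos : 0 < CF) (hCf_pos : 0 < Cf)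
    (hCF : ∀ i ∈ Finset.Icc 1 m, ∀ z ∈ X, ‖F i z‖ ≤ CF / m)
    (hCf : ∀ i ∈ Finset.Icc 1 m, ∀ z ∈ X, ‖∇ (f i) z‖ ≤ Cf / m)
    -- stepsizes and regularization parameters
    (γ η Γ a b : ℝ) (hγ : 0 < γ) (hη : 0 < η) (ha : 0 < a) (hb : 0 < b)
    (hab : b < a) (hab1 : a + b < 1) (hab2 : 3 * a + b < 2)
    (hΓ1 : 1 ≤ Γ) (hΓ2 : 2 * γ * η * μmin ≤ Γ ^ (a + b))
    (hΓ3 : 4 / (γ * η * μmin) ≤ Γ ^ (1 - a - b))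
    -- the iterates
    (x : ℕ → ℕ → EuclideanSpace ℝ (Fin n))
    (hx : IsPairIG m X f F (powSeq γ Γ a) (powSeq η Γ b) x) :
    -- the Tikhonov trajectory is well defined
    (∀ k : ℕ, ∃! y, y ∈ VISol X (regMap m f F (powSeq η Γ b k))) ∧
    -- and the iterates satisfy the error bound
    ∀ xstar : ℕ → EuclideanSpace ℝ (Fin n),
      (∀ k : ℕ, xstar k ∈ VISol X (regMap m f F (powSeq η Γ b k))) →
      ∀ k : ℕ, ∀ i ∈ Finset.Icc 1 m,
        ‖x (k + 1) i - xstar k‖ ^ 2 ≤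
          2 * ((i : ℝ) - 1) ^ 2 * (CF + powSeq η Γ b 0 * Cf) ^ 2 * γ ^ 2
              / ((m : ℝ) ^ 2 * ((k : ℝ) + Γ + 1) ^ (2 * a))
            + 2 * constτ ‖x 1 1 - xstar 0‖ m CF Cf μmin γ η Γ a b
                * constB₀ m CF Cf μmin γ η Γ a b * γ
              / (μmin * η * ((k : ℝ) + Γ) ^ (a - b)) := by
  have hΓ : 0 < Γ := by linarith
  have hM : (0 : ℝ) < m := by exact_mod_cast hm
  have hμ : 0 < μmin := by
    obtain ⟨i, hi, rfl⟩ := hμmin.1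
    exact hμ_pos i (Finset.mem_Icc.2 hi)
  have hμle : ∀ i ∈ Finset.Icc 1 m, μmin ≤ μ i := fun i hi =>
    hμmin.2 ⟨i, Finset.mem_Icc.1 hi, rfl⟩
  have hcl := hX_comp.isClosed
  have hηpos : ∀ k, 0 < powSeq η Γ b k := powSeq_pos hη hΓ
  have hγpos : ∀ k, 0 < powSeq γ Γ a k := powSeq_pos hγ hΓ
  have hgrad : ∀ i ∈ Finset.Icc 1 m, ∀ p ∈ X, ∀ q ∈ X,
      μmin * ‖p - q‖ ^ 2 ≤ ⟪∇ (f i) p - ∇ (f i) q, p - q⟫_ℝ := fun i hi p hp q hq =>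
    (mul_le_mul_of_nonneg_right (hμle i hi) (sq_nonneg _)).trans
      ((hf_sc i hi).inner_gradient_sub_ge hp hq
        ((hf_C1 i hi p hp).differentiableAt one_ne_zero)
        ((hf_C1 i hi q hq).differentiableAt one_ne_zero))
  let g : ℕ → ℕ → EuclideanSpace ℝ (Fin n) → EuclideanSpace ℝ (Fin n) :=
    fun k i z => F i z + powSeq η Γ b k • ∇ (f i) z
  have hgmono : ∀ k, ∀ i ∈ Finset.Icc 1 m, ∀ p ∈ X, ∀ q ∈ X,
      powSeq η Γ b k * μmin * ‖p - q‖ ^ 2 ≤ ⟪g k i p - g k i q, p - q⟫_ℝ := by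
    intro k i hi p hp q hq
    have e : g k i p - g k i q = (F i p - F i q) + powSeq η Γ b k • (∇ (f i) p - ∇ (f i) q) := by
      simp only [g]; module
    have h1 := hF_mono i hi p hp q hq
    have h2 := mul_le_mul_of_nonneg_left (hgrad i hi p hp q hq) (hηpos k).le
    rw [e, inner_add_left, inner_smul_left, conj_trivial]
    linarith
  have hreg : ∀ k, regMap m f F (powSeq η Γ b k) = fun z => ∑ i ∈ Finset.Icc 1 m, g k i z :=
    fun k => rfl
  have hregcont : ∀ k, ContinuousOn (regMap m f F (powSeq η Γ b k)) X := by
    refine fun k => continuousOn_finsetSum _ fun i hi => (hF_cont i hi).add ?_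
    have hg : ContinuousOn (∇ (f i)) X := fun z hz =>
      (hf_C1 i hi z hz).continuousAt_gradient.continuousWithinAt
    fun_prop
  refine ⟨fun k => existsUnique_mem_VISol (mul_pos hM (mul_pos (hηpos k) hμ)) hX_ne hX_conv
    hX_comp (sum_strongly_monotone (hgmono k)) (hregcont k), fun xstar hstar => ?_⟩
  set C : ℝ := CF + powSeq η Γ b 0 * Cf with hC
  have hgbd : ∀ k, ∀ i ∈ Finset.Icc 1 m, ∀ p ∈ X, ‖g k i p‖ ≤ C / m := by
    intro k i hi p hp
    have h1 := norm_add_le (F i p) (powSeq η Γ b k • ∇ (f i) p)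
    rw [norm_smul, Real.norm_of_nonneg (hηpos k).le] at h1
    have h2 : powSeq η Γ b k * ‖∇ (f i) p‖ ≤ powSeq η Γ b 0 * (Cf / m) :=
      mul_le_mul (powSeq_antitone hη hΓ hb.le (Nat.zero_le k)) (hCf i hi p hp) (norm_nonneg _)
        (hηpos 0).le
    have h3 := hCF i hi p hp
    have e : C / m = CF / m + powSeq η Γ b 0 * (Cf / m) := by rw [hC]; ring
    rw [e]
    exact h1.trans (add_le_add h3 h2)
  have hmem : ∀ k, ∀ i ∈ Finset.Icc 1 m, x k i ∈ X := fun k i hi =>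
    hx.mem hcl k (Finset.Icc_subset_Icc_right (Nat.le_succ m) hi)
  have hdist : ∀ k, ∀ i ∈ Finset.Icc 1 m,
      ‖x k i - x k 1‖ ≤ ((i : ℝ) - 1) * (powSeq γ Γ a k * (C / m)) := fun k i hi =>
    incremental_dist_le (g := g k) (hγpos k).le hcl hX_conv (hgbd k) (hmem k) (hx.step k) hi
  have hone : 1 ∈ Finset.Icc 1 m := Finset.mem_Icc.2 ⟨le_rfl, hm⟩
  have hpass : ∀ k, ‖x (k + 1) 1 - xstar k‖ ^ 2
      ≤ (1 - 2 * (γ * η * μmin / ((k : ℝ) + Γ) ^ (a + b))) * ‖x k 1 - xstar k‖ ^ 2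
        + powSeq γ Γ a k ^ 2 * C ^ 2 := by
    intro k
    have h1 := incremental_pass_le (g := g k) (hγpos k).le hcl hX_conv (hgmono k)
      (hgbd k) (hmem k) (hx.step k) (hdist k) (hstar k).1 le_rfl
    have h2 := (hstar k).2 _ (hmem k 1 hone)
    rw [hreg k] at h2
    -- Of the strong monotonicity terms of the pass only `i = 1` is kept; this is why the
    -- contraction carries no factor `m`.
    have h3 : ‖x k 1 - xstar k‖ ^ 2 ≤ ∑ i ∈ Finset.Icc 1 m, ‖x k i - xstar k‖ ^ 2 :=
      Finset.single_le_sum (f := fun i => ‖x k i - xstar k‖ ^ 2) (fun i _ => sq_nonneg _) hone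
    have e1 : (m : ℝ) ^ 2 * (powSeq γ Γ a k * (C / m)) ^ 2 = powSeq γ Γ a k ^ 2 * C ^ 2 := by
      field_simp
    have e2 : γ * η * μmin / ((k : ℝ) + Γ) ^ (a + b)
        = powSeq γ Γ a k * (powSeq η Γ b k * μmin) := by
      rw [← mul_assoc, powSeq_mul_powSeq hΓ]; ring
    have h4 := mul_nonneg (mul_nonneg zero_le_two (hγpos k).le) h2
    have h5 := mul_le_mul_of_nonneg_left h3
      (mul_nonneg (mul_nonneg zero_le_two (hγpos k).le) (mul_pos (hηpos k) hμ).le)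
    rw [hx.next, e2]
    rw [e1] at h1
    linarith
  have hdrift : ∀ k : ℕ, m * μmin * ‖xstar (k + 1) - xstar k‖
      ≤ Cf * (1 / (((k + 1 : ℕ) : ℝ) + Γ)) := by
    intro k
    have hu := hstar (k + 1)
    have hv := hstar k
    rw [regMap_eq_add_smul] at hu hv
    refine tikhonov_dist_le ?_ (sum_strongly_monotone hgrad) (hηpos (k + 1))
      (powSeq_antitone hη hΓ hb.le (Nat.le_succ k))
      (powSeq_sub_succ_le hη hΓ1 hb.le (by linarith) k) (fun p hp => ?_) hu hv
    · intro p hp q hq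
      -- Modulus `0` is plain monotonicity.
      have := sum_strongly_monotone (s := 0) (g := F) (m := m)
        (fun i hi p hp q hq => by simpa using hF_mono i hi p hp q hq) p hp q hq
      simpa using this
    · refine (norm_sum_le_of_le _ fun i hi => hCf i hi p hp).trans (le_of_eq ?_)
      simp only [Finset.sum_const, Nat.card_Icc, Nat.add_sub_cancel, nsmul_eq_mul]
      field_simp
  set B := constB₀ m CF Cf μmin γ η Γ a b with hB
  have hB0 : 0 < B := by
    have := Real.rpow_pos_of_pos hΓ (2 - 3 * a - b)
    rw [hB, constB₀]
    positivity
  set τ := constτ ‖x 1 1 - xstar 0‖ m CF Cf μmin γ η Γ a b with hτ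
  have hτ2 : 2 ≤ τ := le_max_right _ _
  have hκ : 0 < γ * η * μmin := by positivity
  set K := τ * B * γ / (μmin * η) with hK
  have hK0 : 0 ≤ K := by positivity
  have hhalf : ∀ k : ℕ, γ * η * μmin / ((k : ℝ) + Γ) ^ (a + b) ≤ 1 / 2 := by
    intro k
    have hle : Γ ^ (a + b) ≤ ((k : ℝ) + Γ) ^ (a + b) :=
      Real.rpow_le_rpow hΓ.le (by simp) (by linarith)
    rw [div_le_iff₀ (Real.rpow_pos_of_pos (by positivity) _)]
    linarith
  have hmain : ∀ k : ℕ, ‖x (k + 1) 1 - xstar k‖ ^ 2 ≤ K / ((k : ℝ) + Γ) ^ (a - b) := by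
    intro k
    induction k with
    -- The first entry of the maximum `τ` is chosen to make this case hold.
    | zero =>
      have hΓp : 0 < Γ ^ (a - b) := Real.rpow_pos_of_pos hΓ _
      have h1 : μmin * η * γ⁻¹ * B⁻¹ * Γ ^ (a - b) * ‖x 1 1 - xstar 0‖ ^ 2 ≤ τ := le_max_left _ _
      have e : K / Γ ^ (a - b) = τ * (B * γ / (μmin * η * Γ ^ (a - b))) := by
        rw [hK]; field_simp
      have h2 := mul_le_mul_of_nonneg_right h1
        (by positivity : 0 ≤ B * γ / (μmin * η * Γ ^ (a - b)))
      rw [Nat.cast_zero, zero_add Γ, e, zero_add]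
      refine le_trans (le_of_eq ?_) h2
      field_simp
    | succ k ih =>
      have hk : (0 : ℝ) ≤ k := k.cast_nonneg
      have ht2 : 2 ≤ ((k + 1 : ℕ) : ℝ) + Γ := by push_cast; linarith
      have et : ((k + 1 : ℕ) : ℝ) + Γ - 1 = k + Γ := by push_cast; ring
      have hΓt : Γ ≤ ((k + 1 : ℕ) : ℝ) + Γ := by push_cast; linarith
      have hp := hpass (k + 1)
      have hh := hhalf (k + 1)
      have hdr := tikhonov_drift_le hM hμ hγ hη hΓ hab2 hΓt (norm_nonneg _) (hdrift k)
      rw [powSeq] at hp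
      set t := ((k + 1 : ℕ) : ℝ) + Γ
      have ht0 : 0 < t := by linarith
      have hs0 : 0 < γ * η * μmin / t ^ (a + b) := div_pos hκ (Real.rpow_pos_of_pos ht0 _)
      have htri : ‖x (k + 1) 1 - xstar (k + 1)‖
          ≤ ‖x (k + 1) 1 - xstar k‖ + ‖xstar (k + 1) - xstar k‖ := by
        rw [norm_sub_rev (xstar (k + 1))]
        exact norm_sub_le_norm_sub_add_norm_sub _ _ _
      have hy := one_sub_two_mul_mul_sq_le hs0 hh (norm_nonneg _) htri
      have hrec : ‖x (k + 1 + 1) 1 - xstar (k + 1)‖ ^ 2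
          ≤ (1 - γ * η * μmin / t ^ (a + b)) * ‖x (k + 1) 1 - xstar k‖ ^ 2
            + (γ / t ^ a) ^ 2 * B := by
        rw [hB, constB₀, ← hC, mul_add]
        linarith
      refine contraction_rate_step ht2 hb hab hab1 hκ
        (hΓ3.trans (Real.rpow_le_rpow hΓ.le hΓt (by linarith))) hK0 (by linarith) ?_ hrec ?_
      · rwa [et]
      · have hA := Real.rpow_pos_of_pos ht0 (a + b)
        have hD := Real.rpow_pos_of_pos ht0 (a - b)
        have hE := Real.rpow_pos_of_pos ht0 a
        have e3 : t ^ (a + b) * t ^ (a - b) = (t ^ a) ^ 2 := by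
          rw [← Real.rpow_natCast (t ^ a), ← Real.rpow_mul ht0.le, ← Real.rpow_add ht0]
          congr 1; push_cast; ring
        -- The constant `K` is tuned so that the admissible error is `τ / 2` times the actual one;
        -- hence the requirement `τ ≥ 2`.
        have e4 : γ * η * μmin / t ^ (a + b) * (K / 2 / t ^ (a - b))
            = (γ / t ^ a) ^ 2 * B * (τ / 2) := by
          rw [div_pow, ← e3, hK]; field_simp
        rw [e4]
        exact le_mul_of_one_le_right (by positivity) (by linarith)
  intro k i hi
  have h1 := hmain k
  have h2 := hdist (k + 1) i hi
  -- Splitting at the start of the pass by `(p + q)² ≤ 2p² + 2q²` gives the factor `2` in both terms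
  -- of the bound.
  have h3 : ‖x (k + 1) i - xstar k‖ ^ 2
      ≤ 2 * ‖x (k + 1) i - x (k + 1) 1‖ ^ 2 + 2 * ‖x (k + 1) 1 - xstar k‖ ^ 2 := by
    have h := pow_le_pow_left₀ (norm_nonneg _)
      (norm_sub_le_norm_sub_add_norm_sub (x (k + 1) i) (x (k + 1) 1) (xstar k)) 2
    nlinarith [sq_nonneg (‖x (k + 1) i - x (k + 1) 1‖ - ‖x (k + 1) 1 - xstar k‖)]
  have h4 := pow_le_pow_left₀ (norm_nonneg _) h2 2
  have ht : (0 : ℝ) < k + Γ + 1 := by positivity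
  have e1 : (((i : ℝ) - 1) * (powSeq γ Γ a (k + 1) * (C / m))) ^ 2
      = ((i : ℝ) - 1) ^ 2 * C ^ 2 * γ ^ 2 / ((m : ℝ) ^ 2 * ((k : ℝ) + Γ + 1) ^ (2 * a)) := by
    have e : ((k + 1 : ℕ) : ℝ) + Γ = k + Γ + 1 := by push_cast; ring
    have e' : ((k : ℝ) + Γ + 1) ^ (2 * a) = (((k : ℝ) + Γ + 1) ^ a) ^ 2 := by
      rw [← Real.rpow_natCast, ← Real.rpow_mul ht.le]
      congr 1; push_cast; ring
    rw [powSeq, e, e']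
    have := Real.rpow_pos_of_pos ht a
    field_simp
  have hD : 0 < ((k : ℝ) + Γ) ^ (a - b) := Real.rpow_pos_of_pos (by positivity) _
  calc ‖x (k + 1) i - xstar k‖ ^ 2
      ≤ 2 * (((i : ℝ) - 1) ^ 2 * C ^ 2 * γ ^ 2 / ((m : ℝ) ^ 2 * ((k : ℝ) + Γ + 1) ^ (2 * a)))
        + 2 * (K / ((k : ℝ) + Γ) ^ (a - b)) := by linarith
    _ = _ := by
      have e2 : 2 * (K / ((k : ℝ) + Γ) ^ (a - b))
          = 2 * τ * B * γ / (μmin * η * ((k : ℝ) + Γ) ^ (a - b)) := by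
        rw [hK]; field_simp
      rw [e2]; ring
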